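/- Let $F\in\mathbb C[x_0,\dots,x_N]$ be an irreducible homogeneous polynomial of degree $d>1$, and let $Y\subset\mathbb P^N$ be the hypersurface $F=0$. Let $\phi:\mathbb P^N\dashrightarrow\mathbb P^{N*}$, $p\mapsto\bigl(\tfrac{\partial F}{\partial x_0}(p):\dots:\tfrac{\partial F}{\partial x_N}(p)\bigr)$, be the polar map, and let $Z\subset\mathbb P^{N*}$ be its image (the Zariski closure of the set of its values), with $r=\dim Z$. Let $X=Y^*\subset\mathbb P^{N*}$ be the dual variety of $Y$, that is, the Zariski closure of the set of hyperplanes that are tangent to $Y$ at some nonsingular point of $Y$, with $n=\dim X$. Put $\operatorname{def}Y=N-n-1$ and $\operatorname{pdef}Y=N-r$. The hypersurface $Y$ is called dual defective if $\operatorname{def}Y>0$, and polar defective if $Z\ne\mathbb P^{N*}$. Then: (i) $X\subsetneq Z$, and $n+1\le r\le N$. (ii) If $Y$ is polar defective, then $Y$ is dual defective. More precisely, $\operatorname{def}Y\ge\operatorname{pdef}Y$, and this inequality is strict if and only if $r>n+1$. -/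

import Mathlib

open scoped LinearAlgebra.Projectivization

namespace PolarDual

noncomputable section

/-- Complex projective space `ℙ^N` with homogeneous coordinates `x₀, …, x_N`.  The dual space
`ℙ^{N*}` is written in the dual coordinates: a point `h` stands for the hyperplane
`∑ i, h i * x i = 0`. -/
abbrev PSpace (N : ℕ) : Type := ℙ ℂ (Fin (N + 1) → ℂ)

/-- The forms (homogeneous polynomials) in `N + 1` variables, of all degrees. -/
def forms (N : ℕ) : Set (MvPolynomial (Fin (N + 1)) ℂ) := {f | ∃ k, f.IsHomogeneous k}

/-- The projective zero locus of a set of forms (the vanishing of a form at a point does not depend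
on the chosen homogeneous coordinates of the point). -/
def zeroLocus {N : ℕ} (S : Set (MvPolynomial (Fin (N + 1)) ℂ)) : Set (PSpace N) :=
  {p | ∀ f ∈ S, MvPolynomial.eval p.rep f = 0}

/-- The Zariski topology on `ℙ^N`: the closed sets are the zero loci of sets of forms. -/
instance zariskiTopology (N : ℕ) : TopologicalSpace (PSpace N) :=
  TopologicalSpace.ofClosed {A | ∃ S ⊆ forms N, A = zeroLocus S}
    ⟨{1}, by
      rintro f rfl
      exact ⟨0, MvPolynomial.isHomogeneous_one _ _⟩, by
      ext p
      simp [zeroLocus]⟩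
    (by
      intro A hA
      refine ⟨{f | f ∈ forms N ∧ ∃ B ∈ A, ∀ p ∈ B, MvPolynomial.eval p.rep f = 0},
        fun f hf => hf.1, ?_⟩
      ext p
      constructor
      · rintro hp f ⟨-, B, hB, hfB⟩
        exact hfB p (hp B hB)
      · intro hp B hB
        obtain ⟨S, hS, rfl⟩ := hA hB
        intro f hf
        exact hp f ⟨hS hf, _, hB, fun q hq => hq f hf⟩)
    (by
      rintro _ ⟨S, hS, rfl⟩ _ ⟨T, hT, rfl⟩
      refine ⟨{h | ∃ f ∈ S, ∃ g ∈ T, h = f * g}, ?_, ?_⟩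
      · rintro _ ⟨f, hf, g, hg, rfl⟩
        obtain ⟨a, ha⟩ := hS hf
        obtain ⟨b, hb⟩ := hT hg
        exact ⟨a + b, ha.mul hb⟩
      · ext p
        constructor
        · rintro (hp | hp) _ ⟨f, hf, g, hg, rfl⟩
          · simp [hp f hf]
          · simp [hp g hg]
        · intro hp
          by_contra hcon
          simp only [Set.mem_union, not_or, zeroLocus, Set.mem_ofPred_eq, not_forall] at hcon
          obtain ⟨⟨f, hf, hf0⟩, ⟨g, hg, hg0⟩⟩ := hcon
          have := hp (f * g) ⟨f, hf, g, hg, rfl⟩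
          rw [map_mul] at this
          exact (mul_ne_zero hf0 hg0) this)

theorem isClosed_iff {N : ℕ} (A : Set (PSpace N)) :
    IsClosed A ↔ ∃ S ⊆ forms N, A = zeroLocus S := by
  rw [← isOpen_compl_iff]
  change Aᶜᶜ ∈ {A | ∃ S ⊆ forms N, A = zeroLocus S} ↔ _
  rw [compl_compl]
  rfl

/-- The dimension of a subset of `ℙ^N`: its Krull dimension in the Zariski topology, as a natural
number. -/
def dimension {N : ℕ} (A : Set (PSpace N)) : ℕ := ((topologicalKrullDim A).unbotD 0).toNat

/-- The gradient `(∂F/∂x₀, …, ∂F/∂x_N)` at the vector `v`. -/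
def gradient {N : ℕ} (F : MvPolynomial (Fin (N + 1)) ℂ) (v : Fin (N + 1) → ℂ) :
    Fin (N + 1) → ℂ :=
  fun i => MvPolynomial.eval v (MvPolynomial.pderiv i F)

/-- The projective hypersurface `Y` defined by the form `F`. -/
def hypersurface {N : ℕ} (F : MvPolynomial (Fin (N + 1)) ℂ) : Set (PSpace N) := zeroLocus {F}

/-- The base locus of the linear system spanned by the partial derivatives of `F`. -/
def baseLocus {N : ℕ} (F : MvPolynomial (Fin (N + 1)) ℂ) : Set (PSpace N) :=
  {p | gradient F p.rep = 0}

/-- The polar map `φ : ℙ^N ⇢ ℙ^{N*}`, `p ↦ (∂F/∂x₀(p) : … : ∂F/∂x_N(p))`, defined outside of the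
base locus. -/
def polarMap {N : ℕ} (F : MvPolynomial (Fin (N + 1)) ℂ) (p : {p : PSpace N // p ∉ baseLocus F}) :
    PSpace N :=
  Projectivization.mk ℂ (gradient F p.1.rep)
    (show gradient F p.1.rep ≠ 0 from fun h => p.2 h)

/-- The polar image `Z = φ(ℙ^N)`: as for every rational map, the image is the Zariski closure
of the set of values. -/
def polarImage {N : ℕ} (F : MvPolynomial (Fin (N + 1)) ℂ) : Set (PSpace N) :=
  closure (Set.range (polarMap F))

/-- The linear subspace of `ℂ^(N+1)` under the embedded tangent space of the hypersurface `F = 0`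
at the point `y`. -/
def tangentSpace {N : ℕ} (F : MvPolynomial (Fin (N + 1)) ℂ) (y : PSpace N) :
    Submodule ℂ (Fin (N + 1) → ℂ) :=
  LinearMap.ker (Fintype.linearCombination ℂ (gradient F y.rep))

/-- The linear hyperplane of `ℂ^(N+1)` with dual coordinates `h`. -/
def hyperplane {N : ℕ} (h : PSpace N) : Submodule ℂ (Fin (N + 1) → ℂ) :=
  LinearMap.ker (Fintype.linearCombination ℂ h.rep)

/-- The dual variety `X = Y^*` of the hypersurface `Y` with reduced equation `F`: the Zariski
closure in `ℙ^{N*}` of the set of hyperplanes that are tangent to `Y` at a nonsingular point `y` of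
`Y`, that is, that contain the embedded tangent space of `Y` at `y`. -/
def dualVariety {N : ℕ} (F : MvPolynomial (Fin (N + 1)) ℂ) : Set (PSpace N) :=
  closure {h | ∃ y ∈ hypersurface F, y ∉ baseLocus F ∧ tangentSpace F y ≤ hyperplane h}

/-- The dual defect `def Y = codim X - 1 = N - n - 1`, where `n = dim X`. -/
def dualDefect {N : ℕ} (F : MvPolynomial (Fin (N + 1)) ℂ) : ℤ :=
  (N : ℤ) - dimension (dualVariety F) - 1

/-- `Y` is dual defective if its dual defect is positive. -/
def IsDualDefective {N : ℕ} (F : MvPolynomial (Fin (N + 1)) ℂ) : Prop := 0 < dualDefect F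

/-- The polar defect `pdef Y = codim Z = N - r`, where `r = dim Z`. -/
def polarDefect {N : ℕ} (F : MvPolynomial (Fin (N + 1)) ℂ) : ℤ :=
  (N : ℤ) - dimension (polarImage F)

/-- `Y` is polar defective if its polar image is not the whole of `ℙ^{N*}`. -/
def IsPolarDefective {N : ℕ} (F : MvPolynomial (Fin (N + 1)) ℂ) : Prop :=
  polarImage F ⊂ Set.univ

end

end PolarDual

/-! A hyperplane tangent to Y at a nonsingular point y is φ(y), so X ⊆ Z. For strictness, let L be
the field generated by the partials of F. Applying the universal L-derivation D to Euler's identity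
d·F = Σ xᵢ ∂ᵢF gives d·DF = Σ ∂ᵢF·Dxᵢ = DF. As d > 1, DF = 0, so in characteristic zero F is
algebraic over L. The constant term of a suitable relation is a nonzero polynomial in the partials
divisible by F; a homogeneous component of it yields a form vanishing on X but not on Z
(`exists_form_separating`). Since Z is irreducible, a proper closed subset has smaller dimension, so
n + 1 ≤ r; dim ℙ^N ≤ N gives r ≤ N. The defects then satisfy def Y - pdef Y = r - n - 1. -/

namespace PolarDual

/-! ### Differentials and algebraic dependence of F on its partials -/

open scoped TensorProduct in
/-- In characteristic zero, an element of an essentially finitely generated field extension whose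
differential vanishes is algebraic over the base field. -/
theorem isAlgebraic_of_D_eq_zero {L K : Type*} [Field L] [Field K] [Algebra L K] [CharZero L]
    [Algebra.EssFiniteType L K] (x : K) (hx : KaehlerDifferential.D L K x = 0) :
    IsAlgebraic L x := by
  by_contra htr
  have hinj : Function.Injective (Polynomial.aeval (R := L) x) :=
    transcendental_iff_injective.mp htr
  let E := FractionRing (Polynomial L)
  let : Algebra (Polynomial L) K := (Polynomial.aeval (R := L) x).toAlgebra
  have : IsScalarTower L (Polynomial L) K := IsScalarTower.of_algHom (Polynomial.aeval (R := L) x)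
  have : FaithfulSMul (Polynomial L) K := (faithfulSMul_iff_algebraMap_injective _ _).mpr hinj
  let : Algebra E K := FractionRing.liftAlgebra (Polynomial L) K
  have : IsScalarTower (Polynomial L) E K := FractionRing.isScalarTower_liftAlgebra _ _
  have : IsScalarTower L E K := IsScalarTower.to₁₃₄ L (Polynomial L) E K
  have : CharZero E := charZero_of_injective_algebraMap (algebraMap L E).injective
  have : Algebra.EssFiniteType E K := Algebra.EssFiniteType.of_comp L E K
  -- For transcendental x, K is formally smooth over L[X]: a localization followed by a field
  -- extension in characteristic zero. This kills the first cotangent homology, so K ⊗ Ω(L[X]/L)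
  -- embeds in Ω(K/L).
  have : Algebra.FormallySmooth (Polynomial L) E := .of_isLocalization (nonZeroDivisors _)
  have : Algebra.FormallySmooth (Polynomial L) K := .comp _ E _
  have key : Function.Injective (KaehlerDifferential.mapBaseChange L (Polynomial L) K) := by
    rw [injective_iff_map_eq_zero]
    intro y hy
    obtain ⟨y, rfl⟩ := (Algebra.H1Cotangent.exact_δ_mapBaseChange L (Polynomial L) K y).mp hy
    rw [Subsingleton.elim y 0, map_zero]
  have h0 : (1 : K) ⊗ₜ[Polynomial L] KaehlerDifferential.D L (Polynomial L) Polynomial.X = 0 := by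
    apply key
    rw [KaehlerDifferential.mapBaseChange_tmul, KaehlerDifferential.map_D, map_zero, one_smul]
    rw [show algebraMap (Polynomial L) K Polynomial.X = x from Polynomial.aeval_X x, hx]
  -- dX is a free generator of the differentials of L[X], so 1 ⊗ dX cannot vanish.
  have h1 := congrArg (fun z => TensorProduct.rid (Polynomial L) K
    (LinearMap.lTensor K (KaehlerDifferential.polynomialEquiv L).toLinearMap z)) h0
  simp at h1

open MvPolynomial

/-- The chain rule for derivations at polynomial expressions. -/
theorem derivation_aeval_eq_sum {σ L K M : Type*} [Fintype σ] [CommRing L] [CommRing K]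
    [AddCommGroup M] [Algebra ℂ L] [Algebra ℂ K] [Algebra L K] [IsScalarTower ℂ L K] [Module L M]
    [Module K M] (D : Derivation L K M) (x : σ → K) (P : MvPolynomial σ ℂ) :
    D (aeval x P) = ∑ i, aeval x (pderiv i P) • D (x i) := by
  classical
  induction P using MvPolynomial.induction_on with
  | C a =>
    have h : aeval x (C a : MvPolynomial σ ℂ) = algebraMap L K (algebraMap ℂ L a) := by
      rw [aeval_C, ← IsScalarTower.algebraMap_apply]
    rw [h, D.map_algebraMap]
    simp
  | add p q hp hq => simp [hp, hq, add_smul, Finset.sum_add_distrib]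
  | mul_X p i hp =>
    simp [hp, pderiv_X, add_smul, Finset.sum_add_distrib, Finset.smul_sum, Pi.single_apply,
      mul_smul, apply_ite, ite_smul, smul_comm (x i)]

/-- Euler's identity forces the value of a form of degree at least two to be algebraic over each
field that contains the values of its partial derivatives. -/
theorem isAlgebraic_aeval_of_pderiv_mem {σ L K : Type*} [Fintype σ] [Field L] [Field K]
    [Algebra ℂ L] [Algebra ℂ K] [Algebra L K] [IsScalarTower ℂ L K] [Algebra.EssFiniteType ℂ K]
    {d : ℕ} (hd : 1 < d) {F : MvPolynomial σ ℂ} (hFd : F.IsHomogeneous d) (x : σ → K)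
    (h : ∀ i, ∃ a, algebraMap L K a = aeval x (pderiv i F)) : IsAlgebraic L (aeval x F) := by
  have : CharZero L := charZero_of_injective_algebraMap (algebraMap ℂ L).injective
  have : CharZero K := charZero_of_injective_algebraMap (algebraMap ℂ K).injective
  have : Algebra.EssFiniteType L K := Algebra.EssFiniteType.of_comp ℂ L K
  apply isAlgebraic_of_D_eq_zero
  have hp (i) : KaehlerDifferential.D L K (aeval x (pderiv i F)) = 0 := by
    obtain ⟨a, ha⟩ := h i
    rw [← ha, Derivation.map_algebraMap]
  have hE := congrArg (fun P => KaehlerDifferential.D L K (aeval x P)) hFd.sum_X_mul_pderiv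
  simp only [map_sum, map_mul, Derivation.leibniz, hp, smul_zero, zero_add, map_nsmul,
    aeval_X, ← derivation_aeval_eq_sum] at hE
  have h2 : ((d : K) - 1) • KaehlerDifferential.D L K (aeval x F) = 0 := by
    rw [sub_smul, one_smul, Nat.cast_smul_eq_nsmul, ← hE, sub_self]
  refine (smul_eq_zero.mp h2).resolve_left ?_
  rw [← ne_eq, sub_ne_zero]
  exact_mod_cast hd.ne'

theorem isAlgebraic_of_pderiv_mem {σ A : Type*} [Fintype σ] [CommRing A] [IsDomain A] [Algebra ℂ A]
    [Algebra A (MvPolynomial σ ℂ)] [IsScalarTower ℂ A (MvPolynomial σ ℂ)]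
    [FaithfulSMul A (MvPolynomial σ ℂ)] {d : ℕ} (hd : 1 < d) {F : MvPolynomial σ ℂ}
    (hFd : F.IsHomogeneous d) (h : ∀ i, ∃ a : A, algebraMap A _ a = pderiv i F) :
    IsAlgebraic A F := by
  let R := MvPolynomial σ ℂ
  let K := FractionRing R
  let L := FractionRing A
  have : FaithfulSMul A K := FaithfulSMul.trans A R K
  let : Algebra L K := FractionRing.liftAlgebra A K
  have : IsScalarTower A L K := FractionRing.isScalarTower_liftAlgebra _ _
  have : IsScalarTower ℂ A K := IsScalarTower.to₁₂₄ ℂ A R K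
  have : IsScalarTower ℂ L K := IsScalarTower.to₁₃₄ ℂ A L K
  have : Algebra.EssFiniteType R K := .of_isLocalization _ (nonZeroDivisors R)
  have : Algebra.EssFiniteType ℂ K := .comp ℂ R K
  have hev (P : R) : aeval (fun i => algebraMap R K (X i)) P = algebraMap R K P := by
    have := aeval_algebraMap_apply (R := ℂ) K (X : σ → R) P
    rwa [aeval_X_left_apply] at this
  have key := isAlgebraic_aeval_of_pderiv_mem (L := L) hd hFd (fun i => algebraMap R K (X i))
    (fun i => by
      obtain ⟨a, ha⟩ := h i
      refine ⟨algebraMap A L a, ?_⟩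
      rw [← IsScalarTower.algebraMap_apply A L K, hev, IsScalarTower.algebraMap_apply A R K, ha])
  rw [hev, ← IsFractionRing.isAlgebraic_iff A L K] at key
  exact (isAlgebraic_algebraMap_iff (IsFractionRing.injective R K)).mp key

/-- There is a polynomial expression in the partial derivatives of `F` that is nonzero and divisible
by `F`. -/
theorem exists_dvd_aeval_pderiv {σ : Type*} [Fintype σ] {d : ℕ} (hd : 1 < d)
    {F : MvPolynomial σ ℂ} (hF : F ≠ 0) (hFd : F.IsHomogeneous d) :
    ∃ G : MvPolynomial σ ℂ, aeval (fun i => pderiv i F) G ≠ 0 ∧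
      F ∣ aeval (fun i => pderiv i F) G := by
  let A := (aeval (R := ℂ) fun i => pderiv i F).range
  have halg : IsAlgebraic A F := isAlgebraic_of_pderiv_mem hd hFd
    (fun i => ⟨⟨pderiv i F, X i, aeval_X _ i⟩, rfl⟩)
  -- As F is a non-zero-divisor, the relation can be chosen with nonzero constant coefficient; that
  -- coefficient is the required expression.
  obtain ⟨q, hq, hq0⟩ := halg.exists_nonzero_coeff_and_aeval_eq_zero
    (mem_nonZeroDivisors_of_ne_zero hF)
  obtain ⟨G, hG⟩ := (q.coeff 0).2
  have hG' : aeval (fun i => pderiv i F) G = (q.coeff 0 : MvPolynomial σ ℂ) := hG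
  refine ⟨G, ?_, ?_⟩
  · rw [hG']
    exact fun h0 => hq (Subtype.ext h0)
  · rw [hG']
    have h1 := congrArg (Polynomial.aeval F) (Polynomial.divX_mul_X_add q)
    rw [hq0, map_add, map_mul, Polynomial.aeval_X, Polynomial.aeval_C] at h1
    have h2 : Polynomial.aeval F q.divX * F + (q.coeff 0 : MvPolynomial σ ℂ) = 0 := h1
    exact ⟨-Polynomial.aeval F q.divX, by linear_combination h2⟩
-- Dimension of proper closed subsets
open TopologicalSpace

/-- A proper closed subset of an irreducible set has smaller dimension. -/
theorem topologicalKrullDim_add_one_le {T : Type*} [TopologicalSpace T] {A B : Set T}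
    (hA : IsClosed A) (hA0 : A.Nonempty) (hBi : IsIrreducible B) (hAB : A ⊂ B) :
    topologicalKrullDim A + 1 ≤ topologicalKrullDim B := by
  obtain ⟨a, ha⟩ := hA0
  have : Nonempty (IrreducibleCloseds A) :=
    ⟨⟨closure {⟨a, ha⟩}, isIrreducible_singleton.closure, isClosed_closure⟩⟩
  have : IrreducibleSpace B := Subtype.irreducibleSpace hBi
  let j : A → B := Set.inclusion hAB.subset
  have hj : Topology.IsInducing j := (Topology.IsEmbedding.inclusion hAB.subset).isInducing
  -- Each chain in A, after taking closures in B, can be extended by B itself; the added top element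
  -- accounts for the +1.
  let g : WithTop (IrreducibleCloseds A) → IrreducibleCloseds B := fun x =>
    WithTop.recTopCoe ⟨Set.univ, IrreducibleSpace.isIrreducible_univ B, isClosed_univ⟩
      (fun C => IrreducibleCloseds.map j hj.continuous C) x
  have hg : StrictMono g := by
    rw [WithTop.strictMono_iff]
    refine ⟨IrreducibleCloseds.map_strictMono_of_isInducing hj, fun C => ?_⟩
    refine lt_of_le_of_ne (fun _ _ => Set.mem_univ _) fun h => ?_
    obtain ⟨b, hb, hbA⟩ := Set.exists_of_ssubset hAB
    have h1 : (⟨b, hb⟩ : B) ∈ closure (j '' C) := by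
      have : (⟨b, hb⟩ : B) ∈ (g ⊤ : Set B) := Set.mem_univ _
      rwa [← h] at this
    have h2 : closure (j '' C) ⊆ Subtype.val ⁻¹' A :=
      closure_minimal (by rintro _ ⟨x, -, rfl⟩; exact x.2) (hA.preimage continuous_subtype_val)
    exact hbA (h2 h1)
  calc topologicalKrullDim A + 1 = Order.krullDim (WithTop (IrreducibleCloseds A)) :=
        Order.krullDim_WithTop.symm
    _ ≤ topologicalKrullDim B := Order.krullDim_le_of_strictMono g hg

/-! ### Forms, cone ideals and the dimension of projective space -/

theorem eval_smul_of_isHomogeneous {σ : Type*} [Fintype σ] {f : MvPolynomial σ ℂ} {k : ℕ}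
    (hf : f.IsHomogeneous k) (c : ℂ) (v : σ → ℂ) : eval (c • v) f = c ^ k * eval v f := by
  rw [eval_eq', eval_eq', Finset.mul_sum]
  refine Finset.sum_congr rfl fun m hm => ?_
  have hk : ∑ i, m i = k := by
    rw [← hf (mem_support_iff.mp hm), Finsupp.weight_apply, Finsupp.sum_fintype _ _ (by simp)]
    simp
  simp only [Pi.smul_apply, smul_eq_mul, mul_pow, Finset.prod_mul_distrib,
    Finset.prod_pow_eq_pow_sum, hk]
  ring

/-- The homogeneous components of a polynomial that vanishes on a line through the origin vanish on
this line. -/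
theorem eval_homogeneousComponent_eq_zero {σ : Type*} [Fintype σ] {G : MvPolynomial σ ℂ}
    {w : σ → ℂ} (h : ∀ t : ℂ, eval (t • w) G = 0) (k : ℕ) :
    eval w (homogeneousComponent k G) = 0 := by
  -- P(t) = G(t·w) vanishes for all t, so each coefficient is zero.
  let P : Polynomial ℂ := ∑ j ∈ Finset.range (G.totalDegree + 1),
    Polynomial.C (eval w (homogeneousComponent j G)) * Polynomial.X ^ j
  have hP : P = 0 := by
    refine Polynomial.funext fun t => ?_
    rw [Polynomial.eval_zero, ← h t]
    conv_rhs => rw [← sum_homogeneousComponent G]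
    simp only [P, Polynomial.eval_finsetSum, map_sum]
    refine Finset.sum_congr rfl fun j _ => ?_
    rw [eval_smul_of_isHomogeneous (homogeneousComponent_isHomogeneous j G)]
    rw [Polynomial.eval_mul, Polynomial.eval_C, Polynomial.eval_pow, Polynomial.eval_X, mul_comm]
  by_cases hk : k < G.totalDegree + 1
  · have := congrArg (fun p => Polynomial.coeff p k) hP
    simpa [P, Polynomial.finsetSum_coeff, Polynomial.coeff_C_mul_X_pow, hk] using this
  · rw [homogeneousComponent_eq_zero _ _ (by omega), map_zero]

theorem eval_mk_rep_eq_zero_iff {N k : ℕ} {f : MvPolynomial (Fin (N + 1)) ℂ}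
    (hf : f.IsHomogeneous k) {v : Fin (N + 1) → ℂ} (hv : v ≠ 0) :
    eval (Projectivization.mk ℂ v hv).rep f = 0 ↔ eval v f = 0 := by
  obtain ⟨a, ha⟩ := Projectivization.exists_smul_eq_mk_rep ℂ v hv
  rw [← ha, Units.smul_def, eval_smul_of_isHomogeneous hf]
  simp

/-- The homogeneous ideal of a subset of projective space, as the vanishing ideal of its affine
cone. -/
noncomputable def coneIdeal {N : ℕ} (A : Set (PSpace N)) : Ideal (MvPolynomial (Fin (N + 1)) ℂ) :=
  vanishingIdeal ℂ {v | ∃ p ∈ A, ∃ t : ℂ, v = t • p.rep}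

theorem mem_coneIdeal {N : ℕ} {A : Set (PSpace N)} {f : MvPolynomial (Fin (N + 1)) ℂ} :
    f ∈ coneIdeal A ↔ ∀ p ∈ A, ∀ t : ℂ, eval (t • p.rep) f = 0 := by
  simp only [coneIdeal, mem_vanishingIdeal_iff, Set.mem_ofPred_eq, aeval_eq_eval]
  constructor
  · exact fun h p hp t => h _ ⟨p, hp, t, rfl⟩
  · rintro h _ ⟨p, hp, t, rfl⟩
    exact h p hp t

theorem mem_coneIdeal_of_isHomogeneous {N k : ℕ} {A : Set (PSpace N)}
    {f : MvPolynomial (Fin (N + 1)) ℂ} (hf : f.IsHomogeneous k) :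
    f ∈ coneIdeal A ↔ ∀ p ∈ A, eval p.rep f = 0 := by
  rw [mem_coneIdeal]
  refine forall₂_congr fun p _ => ⟨fun h => by simpa using h 1, fun h t => ?_⟩
  rw [eval_smul_of_isHomogeneous hf, h, mul_zero]

-- The ideal is homogeneous, so primality need only be tested on forms, where it is irreducibility
-- of A applied to two hypersurfaces.
attribute [local instance] MvPolynomial.gradedAlgebra in
theorem isPrime_coneIdeal {N : ℕ} {A : Set (PSpace N)} (hA : IsIrreducible A) :
    (coneIdeal A).IsPrime := by
  refine Ideal.IsHomogeneous.isPrime_of_homogeneous_mem_or_mem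
    (𝒜 := homogeneousSubmodule (Fin (N + 1)) ℂ) ?_ ?_ ?_
  · intro k f hf
    have h1 : ((DirectSum.decompose (homogeneousSubmodule (Fin (N + 1)) ℂ) f) k :
        MvPolynomial (Fin (N + 1)) ℂ) = homogeneousComponent k f :=
      decomposition.decompose'_apply f k
    rw [h1, mem_coneIdeal_of_isHomogeneous (homogeneousComponent_isHomogeneous k f)]
    rw [mem_coneIdeal] at hf
    exact fun p hp => eval_homogeneousComponent_eq_zero (hf p hp) k
  · rw [Ideal.ne_top_iff_one, mem_coneIdeal]
    obtain ⟨p, hp⟩ := hA.nonempty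
    exact fun h => one_ne_zero ((map_one (eval _)).symm.trans (h p hp 1))
  · rintro f g ⟨a, hf⟩ ⟨b, hg⟩ hfg
    rw [mem_homogeneousSubmodule] at hf hg
    rw [mem_coneIdeal_of_isHomogeneous (hf.mul hg)] at hfg
    rw [mem_coneIdeal_of_isHomogeneous hf, mem_coneIdeal_of_isHomogeneous hg]
    have := isPreirreducible_iff_isClosed_union_isClosed.mp hA.isPreirreducible
      (zeroLocus {f}) (zeroLocus {g})
      ((isClosed_iff _).mpr ⟨_, by rintro _ rfl; exact ⟨a, hf⟩, rfl⟩)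
      ((isClosed_iff _).mpr ⟨_, by rintro _ rfl; exact ⟨b, hg⟩, rfl⟩)
      (fun p hp => by simpa [zeroLocus] using hfg p hp)
    simpa [Set.subset_def, zeroLocus] using this

theorem subset_of_coneIdeal_le {N : ℕ} {A B : Set (PSpace N)} (hA : IsClosed A)
    (h : coneIdeal A ≤ coneIdeal B) : B ⊆ A := by
  obtain ⟨S, hS, rfl⟩ := (isClosed_iff A).mp hA
  intro p hp f hf
  obtain ⟨k, hk⟩ := hS hf
  exact (mem_coneIdeal_of_isHomogeneous hk).mp
    (h ((mem_coneIdeal_of_isHomogeneous hk).mpr fun q hq => hq f hf)) p hp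

theorem coneIdeal_anti {N : ℕ} {A B : Set (PSpace N)} (h : A ⊆ B) : coneIdeal B ≤ coneIdeal A :=
  fun _ hf => mem_coneIdeal.mpr fun p hp => mem_coneIdeal.mp hf p (h hp)

theorem topologicalKrullDim_pSpace_le (N : ℕ) : topologicalKrullDim (PSpace N) ≤ N := by
  rcases isEmpty_or_nonempty (IrreducibleCloseds (PSpace N)) with h | h
  · rw [topologicalKrullDim, Order.krullDim_eq_bot]
    exact bot_le
  let m : PrimeSpectrum (MvPolynomial (Fin (N + 1)) ℂ) :=
    ⟨RingHom.ker (eval (0 : Fin (N + 1) → ℂ)), RingHom.ker_isPrime _⟩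
  -- Cone ideals of nonempty sets lie strictly inside the ideal `m` of the origin. Adjoining `m`
  -- lengthens every chain by one, which offsets the Krull dimension N + 1 of the polynomial ring.
  let g : WithBot (IrreducibleCloseds (PSpace N)) →
      (PrimeSpectrum (MvPolynomial (Fin (N + 1)) ℂ))ᵒᵈ := fun x =>
    WithBot.recBotCoe (OrderDual.toDual m)
      (fun A => OrderDual.toDual ⟨coneIdeal A, isPrime_coneIdeal A.isIrreducible⟩) x
  have hg : StrictMono g := by
    rw [WithBot.strictMono_iff]
    refine ⟨fun A B hAB => ?_, fun A => ?_⟩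
    · refine OrderDual.toDual_lt_toDual.mpr ((PrimeSpectrum.asIdeal_lt_asIdeal _ _).mp ?_)
      exact lt_of_le_not_ge (coneIdeal_anti hAB.le) fun h =>
        not_le_of_gt hAB (subset_of_coneIdeal_le A.isClosed h)
    · refine OrderDual.toDual_lt_toDual.mpr ((PrimeSpectrum.asIdeal_lt_asIdeal _ _).mp ?_)
      obtain ⟨p, hp⟩ := A.isIrreducible.nonempty
      refine lt_of_le_not_ge (fun f hf => ?_) fun h => p.rep_nonzero (funext fun i => ?_)
      · have := mem_coneIdeal.mp hf p hp 0
        rwa [zero_smul] at this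
      · have := mem_coneIdeal.mp (h (show X i ∈ RingHom.ker _ by simp)) p hp 1
        simpa using this
  have h1 := Order.krullDim_le_of_strictMono g hg
  rw [Order.krullDim_withBot, Order.krullDim_orderDual] at h1
  change topologicalKrullDim (PSpace N) + 1 ≤ ringKrullDim _ at h1
  rw [ringKrullDim_of_isNoetherianRing, ringKrullDim_eq_zero_of_field, zero_add,
    Nat.card_eq_fintype_card, Fintype.card_fin, Nat.cast_add, Nat.cast_one] at h1
  exact ENat.WithBot.add_le_add_one_right_iff.mp h1

/-! ### The separating form and nonsingular points -/

theorem gradient_smul {N d : ℕ} {F : MvPolynomial (Fin (N + 1)) ℂ} (hFd : F.IsHomogeneous d)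
    (c : ℂ) (v : Fin (N + 1) → ℂ) : gradient F (c • v) = c ^ (d - 1) • gradient F v :=
  funext fun _ => eval_smul_of_isHomogeneous hFd.pderiv c v

theorem eval_aeval_pderiv {N : ℕ} (F G : MvPolynomial (Fin (N + 1)) ℂ) (v : Fin (N + 1) → ℂ) :
    eval v (aeval (fun i => pderiv i F) G) = eval (gradient F v) G := by
  have h : (aeval v).comp (aeval (R := ℂ) fun i => pderiv i F) =
      aeval (R := ℂ) (gradient F v) := by
    ext i
    simp [gradient, aeval_eq_eval]
  simpa [aeval_eq_eval] using AlgHom.congr_fun h G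

/-- Some form vanishes at the gradients of `F` at all zeros of `F`, but not at all gradients of
`F`. -/
theorem exists_form_separating {N d : ℕ} (hd : 1 < d) {F : MvPolynomial (Fin (N + 1)) ℂ}
    (hF : F ≠ 0) (hFd : F.IsHomogeneous d) :
    ∃ (G : MvPolynomial (Fin (N + 1)) ℂ) (k : ℕ), G.IsHomogeneous k ∧
      aeval (fun i => pderiv i F) G ≠ 0 ∧ ∀ v, eval v F = 0 → eval (gradient F v) G = 0 := by
  obtain ⟨G, hG0, hG⟩ := exists_dvd_aeval_pderiv hd hF hFd
  have hv (v) (hv : eval v F = 0) : eval (gradient F v) G = 0 := by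
    obtain ⟨Q, hQ⟩ := hG
    rw [← eval_aeval_pderiv, hQ, map_mul, hv, zero_mul]
  obtain ⟨k, hk⟩ : ∃ k, aeval (fun i => pderiv i F) (homogeneousComponent k G) ≠ 0 := by
    by_contra! h
    rw [← sum_homogeneousComponent G, map_sum] at hG0
    exact hG0 (Finset.sum_eq_zero fun k _ => h k)
  refine ⟨_, k, homogeneousComponent_isHomogeneous k G, hk, fun v hv0 =>
    eval_homogeneousComponent_eq_zero (fun t => ?_) k⟩
  -- The gradient has degree d - 1, so t·∇F(v) = ∇F(s·v) with s^(d-1) = t: the whole line through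
  -- ∇F(v) consists of gradients at zeros of F.
  obtain ⟨s, rfl⟩ := IsAlgClosed.exists_pow_nat_eq t (show 0 < d - 1 by omega)
  rw [← gradient_smul hFd]
  exact hv _ (by rw [eval_smul_of_isHomogeneous hFd, hv0, mul_zero])

theorem exists_pderiv_ne_zero {N d : ℕ} (hd : 1 < d) {F : MvPolynomial (Fin (N + 1)) ℂ}
    (hF : F ≠ 0) (hFd : F.IsHomogeneous d) : ∃ i, pderiv i F ≠ 0 := by
  by_contra! h
  have h1 := hFd.sum_X_mul_pderiv
  simp only [h, mul_zero, Finset.sum_const_zero] at h1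
  exact (smul_ne_zero (by omega) hF) h1.symm

/-- An irreducible hypersurface of degree at least two has a nonsingular point. -/
theorem exists_nonsingular_point {N d : ℕ} (hd : 1 < d) {F : MvPolynomial (Fin (N + 1)) ℂ}
    (hF : Irreducible F) (hFd : F.IsHomogeneous d) :
    ∃ v, eval v F = 0 ∧ gradient F v ≠ 0 := by
  obtain ⟨i, hi⟩ := exists_pderiv_ne_zero hd hF.ne_zero hFd
  by_contra! h
  have hprime : (Ideal.span {F}).IsPrime :=
    (Ideal.span_singleton_prime hF.ne_zero).mpr hF.prime
  -- If Y were singular everywhere, the Nullstellensatz would make F divide a nonzero form of degree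
  -- d - 1.
  have hmem : pderiv i F ∈ Ideal.span {F} := by
    rw [← IsPrime.vanishingIdeal_zeroLocus (K := ℂ) (Ideal.span {F}), mem_vanishingIdeal_iff]
    intro v hv
    rw [aeval_eq_eval]
    exact congrFun (h v (by
      simpa [aeval_eq_eval] using hv F (Ideal.mem_span_singleton_self F))) i
  have h1 := totalDegree_le_of_dvd_of_isDomain (Ideal.mem_span_singleton.mp hmem) hi
  rw [hFd.totalDegree hF.ne_zero, (hFd.pderiv (i := i)).totalDegree hi] at h1
  omega

/-! ### Tangent hyperplanes and the polar map -/

/-- Linear forms with nested kernels are proportional. -/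
theorem polarMap_eq_of_tangentSpace_le {N : ℕ} {F : MvPolynomial (Fin (N + 1)) ℂ}
    {y h : PSpace N} (hy : y ∉ baseLocus F) (hyh : tangentSpace F y ≤ hyperplane h) :
    polarMap F ⟨y, hy⟩ = h := by
  classical
  have h1 := mem_span_of_iInf_ker_le_ker (ι := Unit)
    (L := fun _ => Fintype.linearCombination ℂ (gradient F y.rep))
    (K := Fintype.linearCombination ℂ h.rep) (by rw [iInf_const]; exact hyh)
  rw [Set.range_const, Submodule.mem_span_singleton] at h1
  obtain ⟨a, ha⟩ := h1
  rw [← h.mk_rep, polarMap, Projectivization.mk_eq_mk_iff']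
  have h2 : a • gradient F y.rep = h.rep := by
    funext i
    have := LinearMap.congr_fun ha (Pi.single i 1)
    simpa using this
  have ha0 : a ≠ 0 := by
    rintro rfl
    exact h.rep_nonzero (by rw [← h2, zero_smul])
  exact ⟨a⁻¹, by rw [← h2, inv_smul_smul₀ ha0]⟩

theorem dualVariety_subset_polarImage {N : ℕ} (F : MvPolynomial (Fin (N + 1)) ℂ) :
    dualVariety F ⊆ polarImage F :=
  closure_mono fun _ ⟨y, _, hy, hyh⟩ =>
    ⟨⟨y, hy⟩, polarMap_eq_of_tangentSpace_le hy hyh⟩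

theorem ne_zero_of_gradient_ne_zero {N d : ℕ} (hd : 1 < d) {F : MvPolynomial (Fin (N + 1)) ℂ}
    (hFd : F.IsHomogeneous d) {v : Fin (N + 1) → ℂ} (hv : gradient F v ≠ 0) : v ≠ 0 := by
  rintro rfl
  have := gradient_smul hFd 0 (0 : Fin (N + 1) → ℂ)
  rw [zero_smul, zero_pow (by omega), zero_smul] at this
  exact hv this

theorem mk_notMem_baseLocus {N d : ℕ} {F : MvPolynomial (Fin (N + 1)) ℂ}
    (hFd : F.IsHomogeneous d) {v : Fin (N + 1) → ℂ} (hv0 : v ≠ 0) (hv : gradient F v ≠ 0) :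
    Projectivization.mk ℂ v hv0 ∉ baseLocus F := by
  intro h
  have h1 : gradient F (Projectivization.mk ℂ v hv0).rep = 0 := h
  refine hv (funext fun i => ?_)
  have h2 : eval (Projectivization.mk ℂ v hv0).rep (pderiv i F) = 0 := congrFun h1 i
  exact (eval_mk_rep_eq_zero_iff hFd.pderiv hv0).mp h2

theorem dualVariety_nonempty {N d : ℕ} (hd : 1 < d) {F : MvPolynomial (Fin (N + 1)) ℂ}
    (hF : Irreducible F) (hFd : F.IsHomogeneous d) : (dualVariety F).Nonempty := by
  obtain ⟨v, hv, hgv⟩ := exists_nonsingular_point hd hF hFd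
  have hv0 := ne_zero_of_gradient_ne_zero hd hFd hgv
  have hy := mk_notMem_baseLocus hFd hv0 hgv
  refine ⟨polarMap F ⟨_, hy⟩, subset_closure ⟨_, ?_, hy, ?_⟩⟩
  · rintro _ rfl
    exact (eval_mk_rep_eq_zero_iff hFd hv0).mpr hv
  · obtain ⟨a, ha⟩ := Projectivization.exists_smul_eq_mk_rep ℂ _ (show gradient F _ ≠ 0 from hy)
    intro w hw
    rw [hyperplane, polarMap, ← ha]
    rw [tangentSpace, LinearMap.mem_ker, Fintype.linearCombination_apply] at hw
    rw [LinearMap.mem_ker, Fintype.linearCombination_apply]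
    simp only [Pi.smul_apply, smul_comm _ a, ← Finset.smul_sum, hw, smul_zero]

theorem eval_polarMap_rep_eq_zero_iff {N k : ℕ} {F G : MvPolynomial (Fin (N + 1)) ℂ}
    (hG : G.IsHomogeneous k) (p : {p : PSpace N // p ∉ baseLocus F}) :
    eval (polarMap F p).rep G = 0 ↔ eval (gradient F p.1.rep) G = 0 :=
  eval_mk_rep_eq_zero_iff hG _

/-- A nonzero form is nonzero at some point outside of the base locus. -/
theorem exists_notMem_baseLocus_eval_ne_zero {N d : ℕ} (hd : 1 < d) {F : MvPolynomial (Fin (N + 1)) ℂ}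
    (hF : F ≠ 0) (hFd : F.IsHomogeneous d) {P : MvPolynomial (Fin (N + 1)) ℂ}
    {k : ℕ} (hP : P.IsHomogeneous k) (hP0 : P ≠ 0) :
    ∃ p : {p : PSpace N // p ∉ baseLocus F}, eval p.1.rep P ≠ 0 := by
  obtain ⟨i, hi⟩ := exists_pderiv_ne_zero hd hF hFd
  -- The extra factor forces v off the base locus.
  obtain ⟨v, hv⟩ : ∃ v, eval v (P * pderiv i F) ≠ 0 := by
    by_contra! h
    exact mul_ne_zero hP0 hi (MvPolynomial.funext fun v => by rw [h, map_zero])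
  rw [map_mul, mul_ne_zero_iff] at hv
  have hgv : gradient F v ≠ 0 := fun h => hv.2 (congrFun h i)
  have hv0 := ne_zero_of_gradient_ne_zero hd hFd hgv
  exact ⟨⟨_, mk_notMem_baseLocus hFd hv0 hgv⟩, (eval_mk_rep_eq_zero_iff hP hv0).not.mpr hv.1⟩

theorem isHomogeneous_aeval_pderiv {N d k : ℕ} {F G : MvPolynomial (Fin (N + 1)) ℂ}
    (hFd : F.IsHomogeneous d) (hG : G.IsHomogeneous k) :
    (aeval (fun i => pderiv i F) G).IsHomogeneous ((d - 1) * k) :=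
  hG.aeval _ fun _ => hFd.pderiv

theorem dualVariety_ssubset_polarImage {N d : ℕ} (hd : 1 < d) {F : MvPolynomial (Fin (N + 1)) ℂ}
    (hF : F ≠ 0) (hFd : F.IsHomogeneous d) : dualVariety F ⊂ polarImage F := by
  refine ⟨dualVariety_subset_polarImage F, fun h => ?_⟩
  obtain ⟨G, k, hG, hG0, hGF⟩ := exists_form_separating hd hF hFd
  have hX : dualVariety F ⊆ zeroLocus {G} := by
    refine closure_minimal ?_ ((isClosed_iff _).mpr ⟨_, by rintro _ rfl; exact ⟨k, hG⟩, rfl⟩)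
    rintro _ ⟨y, hyF, hy, hyh⟩ _ rfl
    rw [← polarMap_eq_of_tangentSpace_le hy hyh, eval_polarMap_rep_eq_zero_iff hG]
    exact hGF _ (hyF F rfl)
  obtain ⟨p, hp⟩ := exists_notMem_baseLocus_eval_ne_zero hd hF hFd (isHomogeneous_aeval_pderiv hFd hG) hG0
  rw [eval_aeval_pderiv] at hp
  exact hp ((eval_polarMap_rep_eq_zero_iff hG p).mp <| hX (h (subset_closure ⟨p, rfl⟩)) G rfl)

/-! ### Irreducibility and finiteness of dimension -/

/-- A subset of projective space is irreducible if nonvanishing of forms on it is multiplicative. -/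
theorem isPreirreducible_of_forms {N : ℕ} {A : Set (PSpace N)}
    (h : ∀ f ∈ forms N, ∀ g ∈ forms N, (∃ p ∈ A, eval p.rep f ≠ 0) → (∃ p ∈ A, eval p.rep g ≠ 0) →
      ∃ p ∈ A, eval p.rep (f * g) ≠ 0) : IsPreirreducible A := by
  rw [isPreirreducible_iff_isClosed_union_isClosed]
  intro Z₁ Z₂ h₁ h₂ hA
  obtain ⟨S, hS, rfl⟩ := (isClosed_iff _).mp h₁
  obtain ⟨T, hT, rfl⟩ := (isClosed_iff _).mp h₂
  by_contra! hcon
  obtain ⟨⟨p, hp, hpS⟩, ⟨q, hq, hqT⟩⟩ := hcon.imp Set.not_subset.mp Set.not_subset.mp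
  simp only [zeroLocus, Set.mem_ofPred_eq, not_forall] at hpS hqT
  obtain ⟨f, hf, hfp⟩ := hpS
  obtain ⟨g, hg, hgq⟩ := hqT
  obtain ⟨x, hx, hfg⟩ := h f (hS hf) g (hT hg) ⟨p, hp, hfp⟩ ⟨q, hq, hgq⟩
  rw [map_mul, mul_ne_zero_iff] at hfg
  exact (hA hx).elim (fun hx => hfg.1 (hx f hf)) (fun hx => hfg.2 (hx g hg))

/-- Substituting the partials is a ring homomorphism into a domain, so forms not vanishing on the
image have a product not vanishing there. -/
theorem isPreirreducible_polarImage {N d : ℕ} (hd : 1 < d) {F : MvPolynomial (Fin (N + 1)) ℂ}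
    (hF : F ≠ 0) (hFd : F.IsHomogeneous d) : IsPreirreducible (polarImage F) := by
  refine IsPreirreducible.closure (isPreirreducible_of_forms ?_)
  have key {G : MvPolynomial (Fin (N + 1)) ℂ} {k : ℕ} (hG : G.IsHomogeneous k)
      (h : ∃ p ∈ Set.range (polarMap F), eval p.rep G ≠ 0) :
      aeval (fun i => pderiv i F) G ≠ 0 := by
    obtain ⟨_, ⟨p, rfl⟩, hp⟩ := h
    rw [ne_eq, eval_polarMap_rep_eq_zero_iff hG, ← eval_aeval_pderiv] at hp
    exact fun h0 => hp (by rw [h0, map_zero])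
  rintro f ⟨a, hf⟩ g ⟨b, hg⟩ hf0 hg0
  obtain ⟨p, hp⟩ := exists_notMem_baseLocus_eval_ne_zero hd hF hFd
    (isHomogeneous_aeval_pderiv hFd (hf.mul hg))
    (by rw [map_mul]; exact mul_ne_zero (key hf hf0) (key hg hg0))
  refine ⟨_, ⟨p, rfl⟩, ?_⟩
  rwa [ne_eq, eval_polarMap_rep_eq_zero_iff (hf.mul hg), ← eval_aeval_pderiv]

theorem isPreirreducible_univ (N : ℕ) : IsPreirreducible (Set.univ : Set (PSpace N)) := by
  refine isPreirreducible_of_forms ?_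
  rintro f ⟨a, hf⟩ g ⟨b, hg⟩ ⟨p, -, hp⟩ ⟨q, -, hq⟩
  have hf0 : f ≠ 0 := by rintro rfl; simp at hp
  have hg0 : g ≠ 0 := by rintro rfl; simp at hq
  -- The factor `X 0` keeps v away from the origin.
  obtain ⟨v, hv⟩ : ∃ v, eval v (f * g * X 0) ≠ 0 := by
    by_contra! h
    exact mul_ne_zero (mul_ne_zero hf0 hg0) (X_ne_zero 0)
      (MvPolynomial.funext fun v => by rw [h, map_zero])
  rw [map_mul, mul_ne_zero_iff, eval_X] at hv
  have hv0 : v ≠ 0 := by rintro rfl; exact hv.2 rfl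
  exact ⟨Projectivization.mk ℂ v hv0, Set.mem_univ _,
    (eval_mk_rep_eq_zero_iff (hf.mul hg) hv0).not.mpr hv.1⟩

/-- Excludes the values ⊥ and ⊤, which `dimension` would turn into 0. -/
theorem exists_topologicalKrullDim_eq {N : ℕ} {A : Set (PSpace N)} (hA : A.Nonempty) :
    ∃ n : ℕ, topologicalKrullDim A = n ∧ dimension A = n := by
  obtain ⟨a, ha⟩ := hA
  have : Nonempty (IrreducibleCloseds A) :=
    ⟨⟨closure {⟨a, ha⟩}, isIrreducible_singleton.closure, isClosed_closure⟩⟩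
  have h0 : topologicalKrullDim A ≠ ⊥ := Order.krullDim_ne_bot_iff.mpr this
  have h1 : topologicalKrullDim A ≤ N :=
    (topologicalKrullDim_subspace_le _ A).trans (topologicalKrullDim_pSpace_le N)
  obtain ⟨m, hm⟩ := WithBot.ne_bot_iff_exists.mp h0
  have hmt : m ≠ ⊤ := by
    rintro rfl
    rw [← hm] at h1
    exact absurd h1 (not_le_of_gt (WithBot.coe_lt_coe.mpr (ENat.natCast_lt_top N)))
  lift m to ℕ using hmt
  exact ⟨m, hm.symm, by rw [dimension, ← hm]; simp⟩

end PolarDual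

theorem proposition2p2 (N d : ℕ) (hd : 1 < d) (F : MvPolynomial (Fin (N + 1)) ℂ)
    (hF : Irreducible F) (hFd : F.IsHomogeneous d) :
    PolarDual.dualVariety F ⊂ PolarDual.polarImage F ∧
    (∃ n r : ℕ,
      topologicalKrullDim (PolarDual.dualVariety F) = n ∧
      topologicalKrullDim (PolarDual.polarImage F) = r ∧
      n + 1 ≤ r ∧ r ≤ N ∧
      (PolarDual.polarDefect F < PolarDual.dualDefect F ↔ n + 1 < r)) ∧
    PolarDual.polarDefect F ≤ PolarDual.dualDefect F ∧
    (PolarDual.IsPolarDefective F → PolarDual.IsDualDefective F) := by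
  have hXZ := PolarDual.dualVariety_ssubset_polarImage hd hF.ne_zero hFd
  have hX := PolarDual.dualVariety_nonempty hd hF hFd
  have hZ := hX.mono hXZ.subset
  obtain ⟨n, hn, hn'⟩ := PolarDual.exists_topologicalKrullDim_eq hX
  obtain ⟨r, hr, hr'⟩ := PolarDual.exists_topologicalKrullDim_eq hZ
  have hnr : n + 1 ≤ r := by
    have := PolarDual.topologicalKrullDim_add_one_le isClosed_closure hX
      ⟨hZ, PolarDual.isPreirreducible_polarImage hd hF.ne_zero hFd⟩ hXZ
    rw [hr] at this
    erw [hn] at this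
    exact_mod_cast this
  have hrN : r ≤ N := by
    have := (topologicalKrullDim_subspace_le _ (PolarDual.polarImage F)).trans
      (PolarDual.topologicalKrullDim_pSpace_le N)
    rw [hr] at this
    exact_mod_cast this
  refine ⟨hXZ, ⟨n, r, hn, hr, hnr, hrN, ?_⟩, ?_, fun h => ?_⟩
  · rw [PolarDual.polarDefect, PolarDual.dualDefect, hn', hr']
    omega
  · rw [PolarDual.polarDefect, PolarDual.dualDefect, hn', hr']
    omega
  -- Z is now a proper closed subset of the irreducible ℙ^N, so r + 1 ≤ N, and n + 1 ≤ r makes the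
  -- dual defect positive.
  · have h1 := PolarDual.topologicalKrullDim_add_one_le (A := PolarDual.polarImage F)
      (B := Set.univ) isClosed_closure hZ
      ⟨hZ.mono (Set.subset_univ _), PolarDual.isPreirreducible_univ N⟩ h
    have h2 := h1.trans ((topologicalKrullDim_subspace_le _ _).trans
      (PolarDual.topologicalKrullDim_pSpace_le N))
    erw [hr] at h2
    have h3 : r + 1 ≤ N := by exact_mod_cast h2
    rw [PolarDual.IsDualDefective, PolarDual.dualDefect, hn']
    omega
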